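/- Let $(\Omega,\mathcal F,P)$ be a probability space, $H=L_2(\Omega,\mathcal F,P)$ (real or complex), and let $\Lambda$ be the lattice of all sub-$\sigma$-fields of $\mathcal F$ that contain all $P$-null events; here $x\wedge y$ is the intersection of $x$ and $y$, $x\vee y$ is the $\sigma$-field generated by $x$ and $y$, $0$ is the trivial $\sigma$-field (events of probability $0$ or $1$) and $1=\mathcal F$. For $x\in\Lambda$ let $Q_x:H\to H$ be the orthogonal projection onto the $x$-measurable elements (conditional expectation given $x$). Equip $\Lambda$ with the strong operator topology, the coarsest topology for which $x\mapsto Q_x\psi\in H$ is continuous for every $\psi\in H$. A noise-type Boolean algebra is a sublattice $B\subset\Lambda$ containing $0$ and $1$ which is a Boolean algebra (distributive, and every $x\in B$ has some $x'\in B$ with $x\wedge x'=0$, $x\vee x'=1$) and in which any $x,y\in B$ with $x\wedge y=0$ are independent. Let $\operatorname{Cl}(B)$ be its closure in $\Lambda$; the noise-type completion of $B$ is $$C=\{x\in\operatorname{Cl}(B):\ \exists\,y\in\operatorname{Cl}(B)\ \ x\wedge y=0,\ x\vee y=1\}.$$ For $A\subset\Lambda$ let $H^{(1)}(A)$ be the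 set of all $\psi\in H$ such that, for all $x,y\in A$, $$x\wedge y=0\quad\text{implies}\quad Q_{x\vee y}\psi=Q_x\psi+Q_y\psi. \qquad(*)$$ For a noise-type Boolean algebra $B$, $H^{(1)}(B)$ is the first chaos space. Call $A$ classical if $H^{(1)}(A)$, together with the null events, generates the whole $\sigma$-field $\mathcal F$, and black if $H^{(1)}(A)=\{0\}$. **Proposition.** Let $B$ be a noise-type Boolean algebra and $C$ its noise-type completion. If $\psi\in H$ satisfies $(*)$ for all $x,y\in B$, then $\psi$ satisfies $(*)$ for all $x,y\in C$. Consequently $H^{(1)}(B)=H^{(1)}(C)$; $B$ is classical if and only if $C$ is; and $B$ is black if and only if $C$ is. In particular, if $B_1$ is another noise-type Boolean algebra (on the same probability space) with the same noise-type completion $C$, then $H^{(1)}(B_1)=H^{(1)}(B)$, $B_1$ is classical if and only if $B$ is, and $B_1$ is black if and only if $B$ is. -/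

import Mathlib

open MeasureTheory ProbabilityTheory

noncomputable section

namespace NoiseAlgebra

/-- The `P`-null events. -/
def nullEvents {Ω : Type*} [MeasurableSpace Ω] (P : Measure Ω) : Set (Set Ω) :=
  {s | MeasurableSet s ∧ P s = 0}

/-- `m` is a sub-σ-field of the ambient σ-field that contains all `P`-null events. -/
def IsSubSigmaField {Ω : Type*} [m0 : MeasurableSpace Ω] (P : Measure Ω)
    (m : MeasurableSpace Ω) : Prop :=
  m ≤ m0 ∧ ∀ s ∈ @nullEvents Ω m0 P, MeasurableSet[m] s

/-- The set `Λ` of all sub-σ-fields of the ambient σ-field that contain all null events. -/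
abbrev SigmaField {Ω : Type*} [m0 : MeasurableSpace Ω] (P : Measure Ω) : Type _ :=
  {m : MeasurableSpace Ω // @IsSubSigmaField Ω m0 P m}

/-- The trivial σ-field: all events that are null or have null complement. -/
@[reducible] def trivialSigmaField {Ω : Type*} [m0 : MeasurableSpace Ω] (P : Measure Ω) :
    MeasurableSpace Ω where
  MeasurableSet' s := MeasurableSet[m0] s ∧ (P s = 0 ∨ P sᶜ = 0)
  measurableSet_empty := ⟨MeasurableSet.empty, Or.inl measure_empty⟩
  measurableSet_compl s hs := ⟨hs.1.compl, by rw [compl_compl]; exact hs.2.symm⟩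
  measurableSet_iUnion f hf := by
    refine ⟨MeasurableSet.iUnion fun i => (hf i).1, ?_⟩
    by_cases h : ∀ i, P (f i) = 0
    · exact Or.inl (measure_iUnion_null h)
    · push Not at h
      obtain ⟨i, hi⟩ := h
      exact Or.inr (measure_mono_null (Set.compl_subset_compl.mpr (Set.subset_iUnion f i))
        ((hf i).2.resolve_left hi))

theorem trivialSigmaField_le {Ω : Type*} [m0 : MeasurableSpace Ω] (P : Measure Ω) :
    trivialSigmaField P ≤ m0 := fun _ hs => hs.1

theorem isSubSigmaField_trivial {Ω : Type*} [MeasurableSpace Ω] (P : Measure Ω) :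
    IsSubSigmaField P (trivialSigmaField P) :=
  ⟨trivialSigmaField_le P, fun _ hs => ⟨hs.1, Or.inl hs.2⟩⟩

/-- `x ⊓ y` is the intersection of σ-fields, `x ⊔ y` is the σ-field generated by `x` and `y`. -/
instance {Ω : Type*} [MeasurableSpace Ω] (P : Measure Ω) : Lattice (SigmaField P) :=
  Subtype.lattice
    (fun {_ _} hx hy => ⟨sup_le hx.1 hy.1,
      fun s hs => MeasurableSpace.le_def.mp le_sup_left s (hx.2 s hs)⟩)
    (fun {_ _} hx hy => ⟨inf_le_left.trans hx.1,
      fun s hs => MeasurableSpace.measurableSet_inf.mpr ⟨hx.2 s hs, hy.2 s hs⟩⟩)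

/-- The least element is the trivial σ-field, the greatest one is the ambient σ-field. -/
instance {Ω : Type*} [m0 : MeasurableSpace Ω] (P : Measure Ω) :
    BoundedOrder (SigmaField P) where
  top := ⟨m0, le_rfl, fun _ hs => hs.1⟩
  le_top x := x.2.1
  bot := ⟨trivialSigmaField P, isSubSigmaField_trivial P⟩
  bot_le x := fun s hs => hs.2.elim (fun h => x.2.2 s ⟨hs.1, h⟩)
    (fun h => compl_compl s ▸ @MeasurableSet.compl Ω sᶜ x.1 (x.2.2 sᶜ ⟨hs.1.compl, h⟩))

/-- A noise-type Boolean algebra of σ-fields: a sublattice of `Λ` that contains the least and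
the greatest element of `Λ`, is a Boolean algebra (distributive and complemented), and in which
any two elements with trivial intersection are independent. -/
structure IsNoiseType {Ω : Type*} [MeasurableSpace Ω] (P : Measure Ω)
    (B : Set (SigmaField P)) : Prop where
  bot_mem : ⊥ ∈ B
  top_mem : ⊤ ∈ B
  inf_mem : ∀ x ∈ B, ∀ y ∈ B, x ⊓ y ∈ B
  sup_mem : ∀ x ∈ B, ∀ y ∈ B, x ⊔ y ∈ B
  distrib : ∀ x ∈ B, ∀ y ∈ B, ∀ z ∈ B, x ⊓ (y ⊔ z) = (x ⊓ y) ⊔ (x ⊓ z)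
  exists_compl : ∀ x ∈ B, ∃ y ∈ B, x ⊓ y = ⊥ ∧ x ⊔ y = ⊤
  indep : ∀ x ∈ B, ∀ y ∈ B, x ⊓ y = ⊥ → Indep x.1 y.1 P

/-- The operator `Q_x` on `H = L²(P)`: conditional expectation given `x`, that is, the orthogonal
projection of `H` onto the subspace of `x`-measurable elements. -/
def Q (𝕜 : Type*) [RCLike 𝕜] {Ω : Type*} [MeasurableSpace Ω] {P : Measure Ω}
    (x : SigmaField P) (ψ : Lp 𝕜 2 P) : Lp 𝕜 2 P :=
  (condExpL2 𝕜 𝕜 x.2.1 ψ : Lp 𝕜 2 P)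

/-- The strong operator topology on `Λ`: the coarsest topology such that `x ↦ Q_x ψ` is
continuous for every `ψ ∈ H` (with the norm topology on `H`). -/
@[reducible] def strongTopology (𝕜 : Type*) [RCLike 𝕜] {Ω : Type*} [MeasurableSpace Ω] (P : Measure Ω) :
    TopologicalSpace (SigmaField P) :=
  TopologicalSpace.induced (fun x => Q 𝕜 x) Pi.topologicalSpace

/-- The closure `Cl(B)` of `B` in `Λ`, in the strong operator topology. -/
def strongClosure (𝕜 : Type*) [RCLike 𝕜] {Ω : Type*} [MeasurableSpace Ω] {P : Measure Ω}
    (B : Set (SigmaField P)) : Set (SigmaField P) :=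
  @closure (SigmaField P) (strongTopology 𝕜 P) B

/-- The noise-type completion of `B`: all elements of `Cl(B)` that have a complement
in `Cl(B)`. -/
def completion (𝕜 : Type*) [RCLike 𝕜] {Ω : Type*} [MeasurableSpace Ω] {P : Measure Ω}
    (B : Set (SigmaField P)) : Set (SigmaField P) :=
  {x | x ∈ strongClosure 𝕜 B ∧ ∃ y ∈ strongClosure 𝕜 B, x ⊓ y = ⊥ ∧ x ⊔ y = ⊤}

/-- The additivity condition on `ψ` for all `x`, `y` in `B`. -/
def IsAdditiveOn {𝕜 : Type*} [RCLike 𝕜] {Ω : Type*} [MeasurableSpace Ω] {P : Measure Ω}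
    (B : Set (SigmaField P)) (ψ : Lp 𝕜 2 P) : Prop :=
  ∀ x ∈ B, ∀ y ∈ B, x ⊓ y = ⊥ → Q 𝕜 (x ⊔ y) ψ = Q 𝕜 x ψ + Q 𝕜 y ψ

/-- The first chaos space of `B`, as a linear subspace of `H`. -/
def firstChaos (𝕜 : Type*) [RCLike 𝕜] {Ω : Type*} [MeasurableSpace Ω] {P : Measure Ω}
    (B : Set (SigmaField P)) : Submodule 𝕜 (Lp 𝕜 2 P) where
  carrier := {ψ | IsAdditiveOn B ψ}
  zero_mem' := fun x _ y _ _ => by simp [Q]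
  add_mem' := fun {φ ψ} hφ hψ x hx y hy h => by
    have h1 := hφ x hx y hy h
    have h2 := hψ x hx y hy h
    simp only [Q, map_add, Submodule.coe_add] at h1 h2 ⊢
    rw [h1, h2]; abel
  smul_mem' := fun c ψ hψ x hx y hy h => by
    have h1 := hψ x hx y hy h
    simp only [Q, map_smul, Submodule.coe_smul] at h1 ⊢
    rw [h1, smul_add]

/-- The σ-field generated by a set of elements of `H` together with all null events (the null
events make this independent of the choice of representatives). -/
@[reducible] def generatedSigmaField {𝕜 : Type*} [RCLike 𝕜] {Ω : Type*} [MeasurableSpace Ω] {P : Measure Ω}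
    (S : Set (Lp 𝕜 2 P)) : MeasurableSpace Ω :=
  trivialSigmaField P ⊔ ⨆ ψ ∈ S, MeasurableSpace.comap (ψ : Ω → 𝕜) (borel 𝕜)

/-- `B` is classical if the first chaos space generates the whole ambient σ-field. -/
def IsClassical (𝕜 : Type*) [RCLike 𝕜] {Ω : Type*} [m0 : MeasurableSpace Ω] {P : Measure Ω}
    (B : Set (SigmaField P)) : Prop :=
  generatedSigmaField (firstChaos 𝕜 B : Set (Lp 𝕜 2 P)) = m0

/-- `B` is black if the first chaos space contains only `0`. -/
def IsBlack (𝕜 : Type*) [RCLike 𝕜] {Ω : Type*} [MeasurableSpace Ω] {P : Measure Ω}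
    (B : Set (SigmaField P)) : Prop :=
  ∀ ψ ∈ firstChaos 𝕜 B, ψ = 0

end NoiseAlgebra

end

open scoped Topology
open Filter

noncomputable section

namespace NoiseAlgebra

variable {𝕜 : Type*} [RCLike 𝕜] {Ω : Type*} [m0 : MeasurableSpace Ω] {P : Measure Ω}

/-! Let `ψ` be additive on `B`. Splitting along complements gives, for `u`, `v` in `B`, `Q_u Q_v ψ =
Q_{u ⊓ v} ψ` and `Q_{u ⊔ v} ψ = Q_u ψ + Q_v ψ - Q_{u ⊓ v} ψ` (`IsAdditiveOn.Q_Q_eq_Q_inf`). Let `u →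
x` and `v → y` strongly, with `x ⊓ y = ⊥`. The product formula is symmetric in `u` and `v`, so `Q_x
Q_y ψ = Q_y Q_x ψ`; this vector is measurable for both `x` and `y`, hence equals `Q_⊥ ψ = 0`.
Therefore `Q_{u ⊔ v} ψ → φ = Q_x ψ + Q_y ψ`.

Continuity of the join is not assumed, so `φ` must still be identified with `Q_{x ⊔ y} ψ`. This is
tested on the events `s ∩ t`, `s` in `x` and `t` in `y`, which generate `x ⊔ y`: approximating `s`
and `t` by events of `u` and `v` makes the integral of `ψ - φ` over `s ∩ t` arbitrarily small
(`norm_setIntegral_sub_le`). Additivity thus holds on all of `Cl(B)`. -/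

theorem Q_add (x : SigmaField P) (φ ψ : Lp 𝕜 2 P) : Q 𝕜 x (φ + ψ) = Q 𝕜 x φ + Q 𝕜 x ψ := by
  simp [Q]

theorem Q_sub (x : SigmaField P) (φ ψ : Lp 𝕜 2 P) : Q 𝕜 x (φ - ψ) = Q 𝕜 x φ - Q 𝕜 x ψ := by
  simp [Q]

theorem norm_Q_le (x : SigmaField P) (ψ : Lp 𝕜 2 P) : ‖Q 𝕜 x ψ‖ ≤ ‖ψ‖ :=
  norm_condExpL2_coe_le x.2.1 ψ

theorem aestronglyMeasurable_Q (x : SigmaField P) (ψ : Lp 𝕜 2 P) :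
    AEStronglyMeasurable[x.1] (Q 𝕜 x ψ) P :=
  aestronglyMeasurable_condExpL2 x.2.1 ψ

theorem Q_of_aestronglyMeasurable (x : SigmaField P) {ψ : Lp 𝕜 2 P}
    (h : AEStronglyMeasurable[x.1] ψ P) : Q 𝕜 x ψ = ψ := by
  have : Fact (x.1 ≤ m0) := ⟨x.2.1⟩
  exact congrArg Subtype.val (Submodule.orthogonalProjectionOnto_mem_subspace_eq_self
    (K := lpMeas 𝕜 𝕜 x.1 2 P) ⟨ψ, mem_lpMeas_iff_aestronglyMeasurable.mpr h⟩)

theorem inner_Q_left (x : SigmaField P) (φ ψ : Lp 𝕜 2 P) :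
    inner 𝕜 (Q 𝕜 x φ) ψ = inner 𝕜 φ (Q 𝕜 x ψ) :=
  inner_condExpL2_left_eq_right x.2.1

theorem Q_Q_of_le {x y : SigmaField P} (h : x ≤ y) (ψ : Lp 𝕜 2 P) :
    Q 𝕜 y (Q 𝕜 x ψ) = Q 𝕜 x ψ :=
  Q_of_aestronglyMeasurable y ((aestronglyMeasurable_Q x ψ).mono h)

theorem Q_Q_of_ge {x y : SigmaField P} (h : x ≤ y) (ψ : Lp 𝕜 2 P) :
    Q 𝕜 x (Q 𝕜 y ψ) = Q 𝕜 x ψ :=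
  ext_inner_right 𝕜 fun φ => by
    rw [inner_Q_left, inner_Q_left, Q_Q_of_le h, inner_Q_left]

/-- Since the elements of `Λ` contain all null events, a function that is almost everywhere equal
to an `x`-measurable function is itself `x`-measurable. -/
theorem stronglyMeasurable_of_aestronglyMeasurable (x : SigmaField P) {f : Ω → 𝕜}
    (hf : StronglyMeasurable[m0] f) (h : AEStronglyMeasurable[x.1] f P) :
    StronglyMeasurable[x.1] f := by
  let _ : MeasurableSpace 𝕜 := borel 𝕜
  have : BorelSpace 𝕜 := ⟨rfl⟩
  obtain ⟨g, hg, hfg⟩ := h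
  suffices h : Measurable[x.1] f from h.stronglyMeasurable
  intro s hs
  have hfs : MeasurableSet[m0] (f ⁻¹' s) := hf.measurable hs
  have hgs : MeasurableSet[x.1] (g ⁻¹' s) := hg.measurable hs
  have hgs' : MeasurableSet[m0] (g ⁻¹' s) := x.2.1 _ hgs
  have hne : P {ω | f ω ≠ g ω} = 0 := hfg
  have h1 : MeasurableSet[x.1] (f ⁻¹' s \ g ⁻¹' s) := by
    refine x.2.2 _ ⟨hfs.diff hgs', measure_mono_null (fun ω hω => ?_) hne⟩
    exact fun he : f ω = g ω => hω.2 (show g ω ∈ s from he ▸ hω.1)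
  have h2 : MeasurableSet[x.1] (g ⁻¹' s \ f ⁻¹' s) := by
    refine x.2.2 _ ⟨hgs'.diff hfs, measure_mono_null (fun ω hω => ?_) hne⟩
    exact fun he : f ω = g ω => hω.2 (show f ω ∈ s from he ▸ hω.1)
  have h3 : f ⁻¹' s = (g ⁻¹' s \ (g ⁻¹' s \ f ⁻¹' s)) ∪ (f ⁻¹' s \ g ⁻¹' s) := by
    ext ω; simp only [Set.mem_union, Set.mem_sdiff]; tauto
  rw [h3]
  exact (@MeasurableSet.diff _ x.1 _ _ hgs h2).union h1

/-- Because null events lie in both σ-fields, one and the same representative is measurable for each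
of them. -/
theorem aestronglyMeasurable_inf {x y : SigmaField P} {ψ : Lp 𝕜 2 P}
    (hx : AEStronglyMeasurable[x.1] ψ P) (hy : AEStronglyMeasurable[y.1] ψ P) :
    AEStronglyMeasurable[(x ⊓ y).1] ψ P := by
  let _ : MeasurableSpace 𝕜 := borel 𝕜
  have : BorelSpace 𝕜 := ⟨rfl⟩
  have h1 := stronglyMeasurable_of_aestronglyMeasurable x (Lp.stronglyMeasurable ψ) hx
  have h2 := stronglyMeasurable_of_aestronglyMeasurable y (Lp.stronglyMeasurable ψ) hy
  have h : Measurable[(x ⊓ y).1] (ψ : Ω → 𝕜) := fun s hs =>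
    MeasurableSpace.measurableSet_inf.mpr ⟨h1.measurable hs, h2.measurable hs⟩
  exact h.stronglyMeasurable.aestronglyMeasurable

theorem IsAdditiveOn.Q_bot {B : Set (SigmaField P)} {ψ : Lp 𝕜 2 P} (hψ : IsAdditiveOn B ψ)
    (hB : ⊥ ∈ B) : Q 𝕜 ⊥ ψ = 0 := by
  have h := hψ ⊥ hB ⊥ hB (inf_bot_eq ⊥)
  rw [sup_idem] at h
  simpa using h

/-! ### Independence and vanishing criteria -/

section Independence

variable [IsProbabilityMeasure P]

theorem integral_Q (x : SigmaField P) (ψ : Lp 𝕜 2 P) {s : Set Ω} (hs : MeasurableSet[x.1] s) :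
    ∫ ω in s, Q 𝕜 x ψ ω ∂P = ∫ ω in s, ψ ω ∂P :=
  integral_condExpL2_eq x.2.1 ψ hs (measure_ne_top P s)

/-- Conditioning on an independent σ-field leaves only the mean, and `Q_⊥ ψ = 0` makes the mean
vanish. -/
theorem Q_Q_eq_zero_of_indep {x y : SigmaField P} (h : Indep x.1 y.1 P) {ψ : Lp 𝕜 2 P}
    (hψ : Q 𝕜 ⊥ ψ = 0) : Q 𝕜 x (Q 𝕜 y ψ) = 0 := by
  have hint : ∫ ω, Q 𝕜 y ψ ω ∂P = 0 := by
    have h1 := integral_Q y ψ (@MeasurableSet.univ _ y.1)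
    have h2 := integral_Q ⊥ ψ (@MeasurableSet.univ _ (⊥ : SigmaField P).1)
    rw [hψ, ← h1, setIntegral_univ, setIntegral_univ] at h2
    rw [← h2]
    exact integral_eq_zero_of_ae (Lp.coeFn_zero 𝕜 2 P)
  have hm : StronglyMeasurable[y.1] (Q 𝕜 y ψ : Ω → 𝕜) :=
    stronglyMeasurable_of_aestronglyMeasurable y (Lp.stronglyMeasurable _)
      (aestronglyMeasurable_Q y ψ)
  have h1 := condExp_indep_eq y.2.1 x.2.1 hm h.symm
  have h2 := (Lp.memLp (Q 𝕜 y ψ)).condExpL2_ae_eq_condExp (𝕜 := 𝕜) x.2.1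
  rw [Lp.toLp_coeFn] at h2
  apply Lp.ext
  refine (h2.trans h1).trans ?_
  simp only [hint]
  exact (Lp.coeFn_zero 𝕜 2 P).symm

/-- A function whose integrals over a generating family of intersections vanish is orthogonal to
the `x ⊔ y`-measurable functions. -/
theorem Q_sup_eq_zero {x y : SigmaField P} {δ : Lp 𝕜 2 P}
    (h : ∀ s t, MeasurableSet[x.1] s → MeasurableSet[y.1] t → ∫ ω in s ∩ t, δ ω ∂P = 0) :
    Q 𝕜 (x ⊔ y) δ = 0 := by
  set S : Set (Set Ω) :=
    {r | ∃ s t, MeasurableSet[x.1] s ∧ MeasurableSet[y.1] t ∧ r = s ∩ t} with hS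
  have hle : (x ⊔ y).1 ≤ m0 := (x ⊔ y).2.1
  have hint : Integrable δ P := (Lp.memLp δ).integrable one_le_two
  have hgen : (x ⊔ y).1 = MeasurableSpace.generateFrom S := by
    apply le_antisymm
    · refine sup_le (fun s hs => ?_) (fun t ht => ?_)
      · exact MeasurableSpace.measurableSet_generateFrom
          ⟨s, Set.univ, hs, @MeasurableSet.univ _ y.1, by simp⟩
      · exact MeasurableSpace.measurableSet_generateFrom
          ⟨Set.univ, t, @MeasurableSet.univ _ x.1, ht, by simp⟩
    · refine MeasurableSpace.generateFrom_le ?_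
      rintro _ ⟨s, t, hs, ht, rfl⟩
      exact @MeasurableSet.inter _ (x ⊔ y).1 _ _
        ((le_sup_left : x ≤ x ⊔ y) s hs) ((le_sup_right : y ≤ x ⊔ y) t ht)
  have hpi : IsPiSystem S := by
    rintro _ ⟨s, t, hs, ht, rfl⟩ _ ⟨s', t', hs', ht', rfl⟩ -
    exact ⟨s ∩ s', t ∩ t', @MeasurableSet.inter _ x.1 _ _ hs hs',
      @MeasurableSet.inter _ y.1 _ _ ht ht', Set.inter_inter_inter_comm _ _ _ _⟩
  have huniv : ∫ ω, δ ω ∂P = 0 := by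
    simpa using h Set.univ Set.univ (@MeasurableSet.univ _ x.1) (@MeasurableSet.univ _ y.1)
  have hall : ∀ r, MeasurableSet[(x ⊔ y).1] r → ∫ ω in r, δ ω ∂P = 0 := by
    refine MeasurableSpace.induction_on_inter hgen hpi (by simp) ?_ ?_ ?_
    · rintro _ ⟨s, t, hs, ht, rfl⟩
      exact h s t hs ht
    · intro t ht h0
      have := integral_add_compl (hle t ht) hint
      rwa [h0, zero_add, huniv] at this
    · intro f hd hf h0
      rw [integral_iUnion (fun i => hle _ (hf i)) hd hint.integrableOn]
      simp [h0]
  apply Lp.ext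
  refine (lpMeas.ae_eq_zero_of_forall_setIntegral_eq_zero (𝕜 := 𝕜) hle (condExpL2 𝕜 𝕜 hle δ)
    two_ne_zero ENNReal.ofNat_ne_top (fun s _ hs =>
      integrableOn_condExpL2_of_measure_ne_top hle hs.ne δ) fun s hs _ => ?_).trans
    (Lp.coeFn_zero 𝕜 2 P).symm
  exact (integral_Q (x ⊔ y) δ hs).trans (hall s hs)

end Independence

section NoiseType

variable [IsProbabilityMeasure P] {B : Set (SigmaField P)} {ψ : Lp 𝕜 2 P}

/-- With `x'` a complement of `x`, both `y` and `x ⊔ y` split off the piece `y ⊓ x'`, which is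
independent of `x`, so `Q_x` kills its contribution. -/
theorem IsAdditiveOn.Q_Q_eq_Q_inf (hψ : IsAdditiveOn B ψ) (hB : IsNoiseType P B)
    {x y : SigmaField P} (hx : x ∈ B) (hy : y ∈ B) :
    Q 𝕜 x (Q 𝕜 y ψ) = Q 𝕜 (x ⊓ y) ψ ∧
      Q 𝕜 (x ⊔ y) ψ = Q 𝕜 x ψ + Q 𝕜 y ψ - Q 𝕜 (x ⊓ y) ψ := by
  obtain ⟨x', hx', hinf, hsup⟩ := hB.exists_compl x hx
  have hz : y ⊓ x' ∈ B := hB.inf_mem _ hy _ hx'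
  have hy_eq : (y ⊓ x) ⊔ (y ⊓ x') = y := by
    rw [← hB.distrib y hy x hx x' hx', hsup, inf_top_eq]
  have hxz : x ⊓ (y ⊓ x') = ⊥ := by
    rw [inf_left_comm, hinf, inf_bot_eq]
  have hsup' : x ⊔ (y ⊓ x') = x ⊔ y := by
    conv_rhs => rw [← hy_eq, ← sup_assoc, sup_eq_left.mpr (inf_le_right : y ⊓ x ≤ x)]
  have h1 := hψ x hx _ hz hxz
  have h2 := hψ _ (hB.inf_mem y hy x hx) _ hz
    (by rw [inf_assoc, hxz, inf_bot_eq])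
  rw [hsup'] at h1
  rw [hy_eq] at h2
  have h3 := Q_Q_eq_zero_of_indep (hB.indep x hx _ hz hxz) (hψ.Q_bot hB.bot_mem)
  rw [inf_comm x y, h1, h2, Q_add, h3, Q_Q_of_le inf_le_right]
  exact ⟨add_zero _, by abel⟩

end NoiseType

/-! ### Strong limits of projections -/

section Limits

theorem exists_filter_of_mem_strongClosure {B : Set (SigmaField P)} {x : SigmaField P}
    (hx : x ∈ strongClosure 𝕜 B) : ∃ l : Filter (SigmaField P), l.NeBot ∧ (∀ᶠ u in l, u ∈ B) ∧
      ∀ ψ : Lp 𝕜 2 P, Tendsto (fun u => Q 𝕜 u ψ) l (𝓝 (Q 𝕜 x ψ)) := by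
  let _ := strongTopology 𝕜 P
  refine ⟨𝓝[B] x, mem_closure_iff_nhdsWithin_neBot.mp hx, eventually_mem_nhdsWithin, fun ψ => ?_⟩
  have hc : Continuous (fun u : SigmaField P => Q 𝕜 u) := continuous_induced_dom
  exact ((continuous_apply ψ).comp hc).continuousAt.mono_left nhdsWithin_le_nhds

/-- Composition is jointly continuous here because every `Q_u` is a contraction. -/
theorem tendsto_Q_Q {l : Filter (SigmaField P × SigmaField P)} {x y : SigmaField P}
    (hx : ∀ ψ : Lp 𝕜 2 P, Tendsto (fun p => Q 𝕜 p.1 ψ) l (𝓝 (Q 𝕜 x ψ)))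
    (hy : ∀ ψ : Lp 𝕜 2 P, Tendsto (fun p => Q 𝕜 p.2 ψ) l (𝓝 (Q 𝕜 y ψ))) (ψ : Lp 𝕜 2 P) :
    Tendsto (fun p => Q 𝕜 p.1 (Q 𝕜 p.2 ψ)) l (𝓝 (Q 𝕜 x (Q 𝕜 y ψ))) := by
  have h1 : Tendsto (fun p : SigmaField P × SigmaField P => Q 𝕜 p.1 (Q 𝕜 p.2 ψ - Q 𝕜 y ψ)) l
      (𝓝 0) := by
    refine squeeze_zero_norm (fun p => norm_Q_le _ _) ?_
    simpa using ((hy ψ).sub_const (Q 𝕜 y ψ)).norm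
  simpa [← Q_add] using h1.add (hx (Q 𝕜 y ψ))

end Limits

/-! ### Approximation of events -/

section Approximation

variable [IsProbabilityMeasure P]

/-- The indicator of an event, as an element of `H`. -/
def ind (𝕜 : Type*) [RCLike 𝕜] (P : Measure Ω) [IsProbabilityMeasure P] {s : Set Ω}
    (hs : MeasurableSet s) : Lp 𝕜 2 P :=
  indicatorConstLp 2 hs (measure_ne_top P s) 1

theorem coeFn_ind {s : Set Ω} (hs : MeasurableSet s) :
    ind 𝕜 P hs =ᵐ[P] s.indicator fun _ => (1 : 𝕜) :=
  indicatorConstLp_coeFn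

theorem inner_ind {s : Set Ω} (hs : MeasurableSet s) (ψ : Lp 𝕜 2 P) :
    inner 𝕜 (ind 𝕜 P hs) ψ = ∫ ω in s, ψ ω ∂P :=
  L2.inner_indicatorConstLp_one hs _ ψ

theorem norm_ind_inter_sub_le {s t r : Set Ω} (hs : MeasurableSet s) (ht : MeasurableSet t)
    (hr : MeasurableSet r) :
    ‖ind 𝕜 P (hs.inter hr) - ind 𝕜 P (ht.inter hr)‖ ≤ ‖ind 𝕜 P hs - ind 𝕜 P ht‖ := by
  refine Lp.norm_le_norm_of_ae_le ?_
  filter_upwards [Lp.coeFn_sub (ind 𝕜 P (hs.inter hr)) (ind 𝕜 P (ht.inter hr)),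
    Lp.coeFn_sub (ind 𝕜 P hs) (ind 𝕜 P ht), coeFn_ind (𝕜 := 𝕜) (P := P) (hs.inter hr),
    coeFn_ind (𝕜 := 𝕜) (P := P) (ht.inter hr), coeFn_ind (𝕜 := 𝕜) (P := P) hs,
    coeFn_ind (𝕜 := 𝕜) (P := P) ht] with ω h1 h2 h3 h4 h5 h6
  rw [h1, h2, Pi.sub_apply, Pi.sub_apply, h3, h4, h5, h6]
  by_cases hω : ω ∈ r
  · have e : ∀ q : Set Ω, (q ∩ r).indicator (fun _ => (1 : 𝕜)) ω = q.indicator (fun _ => 1) ω :=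
      fun q => by by_cases hq : ω ∈ q <;> simp [hq, hω]
    rw [e, e]
  · simp [hω]

theorem norm_ind_inter_sub_ind_inter_le {s s' t t' : Set Ω} (hs : MeasurableSet s)
    (hs' : MeasurableSet s') (ht : MeasurableSet t) (ht' : MeasurableSet t') :
    ‖ind 𝕜 P (hs.inter ht) - ind 𝕜 P (hs'.inter ht')‖ ≤
      ‖ind 𝕜 P hs - ind 𝕜 P hs'‖ + ‖ind 𝕜 P ht - ind 𝕜 P ht'‖ := by
  have h1 := norm_ind_inter_sub_le (𝕜 := 𝕜) (P := P) hs hs' ht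
  have h2 := norm_ind_inter_sub_le (𝕜 := 𝕜) (P := P) ht ht' hs'
  simp only [Set.inter_comm _ s'] at h2
  exact (norm_sub_le_norm_sub_add_norm_sub _ (ind 𝕜 P (hs'.inter ht)) _).trans (add_le_add h1 h2)

/-- An event is approximated by a `u`-measurable event as well as by its conditional probability
given `u`, up to a factor `2`. -/
theorem exists_measurableSet_norm_sub_le (u : SigmaField P) {s : Set Ω} (hs : MeasurableSet s) :
    ∃ t, ∃ ht : MeasurableSet[u.1] t, ‖ind 𝕜 P hs - ind 𝕜 P (u.2.1 t ht)‖ ≤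
      2 * ‖ind 𝕜 P hs - Q 𝕜 u (ind 𝕜 P hs)‖ := by
  set f : Lp 𝕜 2 P := Q 𝕜 u (ind 𝕜 P hs) with hf
  have hm : StronglyMeasurable[u.1] (f : Ω → 𝕜) :=
    stronglyMeasurable_of_aestronglyMeasurable u (Lp.stronglyMeasurable _)
      (aestronglyMeasurable_Q u _)
  have hre : Measurable[u.1] fun ω => RCLike.re (f ω) :=
    (RCLike.continuous_re.comp_stronglyMeasurable hm).measurable
  -- Wherever this event disagrees with `s`, the distance from `f` to the indicator of `s` is at
  -- least `1 / 2`; hence the factor `2`.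
  have ht : MeasurableSet[u.1] {ω | 1 / 2 < RCLike.re (f ω)} := hre measurableSet_Ioi
  refine ⟨_, ht, Lp.norm_le_mul_norm_of_ae_le_mul ?_⟩
  filter_upwards [Lp.coeFn_sub (ind 𝕜 P hs) (ind 𝕜 P (u.2.1 _ ht)),
    Lp.coeFn_sub (ind 𝕜 P hs) f, coeFn_ind (𝕜 := 𝕜) (P := P) hs,
    coeFn_ind (𝕜 := 𝕜) (P := P) (u.2.1 _ ht)] with ω h1 h2 h3 h4
  rw [h1, h2, Pi.sub_apply, Pi.sub_apply, h3, h4]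
  have key : ∀ z : 𝕜, RCLike.re z ≤ ‖z‖ := RCLike.re_le_norm
  by_cases hω : ω ∈ s <;> by_cases hω' : ω ∈ {ω | 1 / 2 < RCLike.re (f ω)}
  · rw [Set.indicator_of_mem hω, Set.indicator_of_mem hω', sub_self, norm_zero]
    positivity
  · rw [Set.indicator_of_mem hω, Set.indicator_of_notMem hω', sub_zero, norm_one]
    have h5 := key (1 - f ω)
    have h6 : RCLike.re (f ω) ≤ 1 / 2 := not_lt.mp hω'
    rw [map_sub, RCLike.one_re] at h5
    linarith
  · rw [Set.indicator_of_notMem hω, Set.indicator_of_mem hω', zero_sub, zero_sub, norm_neg,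
      norm_neg, norm_one]
    have h5 := key (f ω)
    have h6 : 1 / 2 < RCLike.re (f ω) := hω'
    linarith
  · rw [Set.indicator_of_notMem hω, Set.indicator_of_notMem hω', sub_self, norm_zero]
    positivity

theorem norm_setIntegral_sub_le (u v : SigmaField P) {s t : Set Ω} (hs : MeasurableSet s)
    (ht : MeasurableSet t) (ψ φ : Lp 𝕜 2 P) :
    ‖∫ ω in s ∩ t, (ψ - φ : Lp 𝕜 2 P) ω ∂P‖ ≤
      (2 * ‖ind 𝕜 P hs - Q 𝕜 u (ind 𝕜 P hs)‖ + 2 * ‖ind 𝕜 P ht - Q 𝕜 v (ind 𝕜 P ht)‖) * ‖ψ - φ‖ +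
        ‖Q 𝕜 (u ⊔ v) ψ - φ‖ := by
  obtain ⟨s', hs', h1⟩ := exists_measurableSet_norm_sub_le (𝕜 := 𝕜) u hs
  obtain ⟨t', ht', h2⟩ := exists_measurableSet_norm_sub_le (𝕜 := 𝕜) v ht
  have hms := u.2.1 _ hs'
  have hmt := v.2.1 _ ht'
  have hst : MeasurableSet[(u ⊔ v).1] (s' ∩ t') := @MeasurableSet.inter _ (u ⊔ v).1 _ _
    ((le_sup_left : u ≤ u ⊔ v) _ hs') ((le_sup_right : v ≤ u ⊔ v) _ ht')
  have h3 := norm_ind_inter_sub_ind_inter_le (𝕜 := 𝕜) (P := P) hs hms ht hmt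
  -- The event `s' ∩ t'` belongs to `u ⊔ v`, so `ψ` may be replaced by its projection.
  have h4 : inner 𝕜 (ind 𝕜 P (hms.inter hmt)) (ψ - φ) =
      inner 𝕜 (ind 𝕜 P (hms.inter hmt)) (Q 𝕜 (u ⊔ v) ψ - φ) := by
    rw [inner_sub_right, inner_sub_right, inner_ind, inner_ind _ (Q 𝕜 (u ⊔ v) ψ),
      integral_Q _ _ hst]
  have h5 : ‖ind 𝕜 P (hms.inter hmt)‖ ≤ 1 := by
    rw [ind, norm_indicatorConstLp two_ne_zero ENNReal.ofNat_ne_top, norm_one, one_mul]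
    exact Real.rpow_le_one measureReal_nonneg measureReal_le_one (by positivity)
  have h6 : inner 𝕜 (ind 𝕜 P (hs.inter ht)) (ψ - φ) =
      inner 𝕜 (ind 𝕜 P (hs.inter ht) - ind 𝕜 P (hms.inter hmt)) (ψ - φ) +
        inner 𝕜 (ind 𝕜 P (hms.inter hmt)) (Q 𝕜 (u ⊔ v) ψ - φ) := by
    rw [← h4, inner_sub_left, sub_add_cancel]
  rw [← inner_ind (hs.inter ht), h6]
  refine (norm_add_le _ _).trans (add_le_add ?_ ?_)
  · refine (norm_inner_le_norm _ _).trans ?_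
    gcongr
    exact h3.trans (add_le_add h1 h2)
  · refine (norm_inner_le_norm _ _).trans ?_
    exact mul_le_of_le_one_left (norm_nonneg _) h5

end Approximation

theorem IsNoiseType.subset_completion {B : Set (SigmaField P)} (hB : IsNoiseType P B) :
    B ⊆ completion 𝕜 B := by
  let _ := strongTopology 𝕜 P
  intro x hx
  obtain ⟨y, hy, h⟩ := hB.exists_compl x hx
  exact ⟨subset_closure hx, y, subset_closure hy, h⟩

/-! ### Passage to the closure and the completion -/

section Completion

variable [IsProbabilityMeasure P] {B : Set (SigmaField P)} {ψ : Lp 𝕜 2 P}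

/-- Additivity passes from a noise-type Boolean algebra to its strong closure. -/
theorem IsAdditiveOn.strongClosure (hψ : IsAdditiveOn B ψ) (hB : IsNoiseType P B) :
    IsAdditiveOn (strongClosure 𝕜 B) ψ := by
  intro x hx y hy hxy
  obtain ⟨l₁, hl₁, hB₁, h₁⟩ := exists_filter_of_mem_strongClosure hx
  obtain ⟨l₂, hl₂, hB₂, h₂⟩ := exists_filter_of_mem_strongClosure hy
  have hlim₁ : ∀ φ : Lp 𝕜 2 P, Tendsto (fun p : SigmaField P × SigmaField P => Q 𝕜 p.1 φ)
      (l₁ ×ˢ l₂) (𝓝 (Q 𝕜 x φ)) := fun φ => (h₁ φ).comp tendsto_fst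
  have hlim₂ : ∀ φ : Lp 𝕜 2 P, Tendsto (fun p : SigmaField P × SigmaField P => Q 𝕜 p.2 φ)
      (l₁ ×ˢ l₂) (𝓝 (Q 𝕜 y φ)) := fun φ => (h₂ φ).comp tendsto_snd
  have hmem : ∀ᶠ p in l₁ ×ˢ l₂, p.1 ∈ B ∧ p.2 ∈ B := hB₁.prod_mk hB₂
  have hxy_lim : Tendsto (fun p : SigmaField P × SigmaField P => Q 𝕜 (p.1 ⊓ p.2) ψ) (l₁ ×ˢ l₂)
      (𝓝 (Q 𝕜 x (Q 𝕜 y ψ))) := by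
    refine (tendsto_Q_Q hlim₁ hlim₂ ψ).congr' ?_
    filter_upwards [hmem] with p hp
    exact (hψ.Q_Q_eq_Q_inf hB hp.1 hp.2).1
  have hyx_lim : Tendsto (fun p : SigmaField P × SigmaField P => Q 𝕜 (p.1 ⊓ p.2) ψ) (l₁ ×ˢ l₂)
      (𝓝 (Q 𝕜 y (Q 𝕜 x ψ))) := by
    refine (tendsto_Q_Q (l := Filter.map Prod.swap (l₁ ×ˢ l₂)) ?_ ?_ ψ |>.comp
      tendsto_map).congr' ?_
    · exact fun φ => tendsto_map'_iff.mpr (hlim₂ φ)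
    · exact fun φ => tendsto_map'_iff.mpr (hlim₁ φ)
    · filter_upwards [hmem] with p hp
      rw [inf_comm]
      exact (hψ.Q_Q_eq_Q_inf hB hp.2 hp.1).1
  have hcomm : Q 𝕜 x (Q 𝕜 y ψ) = Q 𝕜 y (Q 𝕜 x ψ) := tendsto_nhds_unique hxy_lim hyx_lim
  have hzero : Q 𝕜 x (Q 𝕜 y ψ) = 0 := by
    have hm := aestronglyMeasurable_inf (aestronglyMeasurable_Q x (Q 𝕜 y ψ))
      (hcomm ▸ aestronglyMeasurable_Q y (Q 𝕜 x ψ))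
    rw [hxy] at hm
    rw [← Q_of_aestronglyMeasurable ⊥ hm, Q_Q_of_ge bot_le, Q_Q_of_ge bot_le,
      hψ.Q_bot hB.bot_mem]
  have hsup_lim : Tendsto (fun p : SigmaField P × SigmaField P => Q 𝕜 (p.1 ⊔ p.2) ψ) (l₁ ×ˢ l₂)
      (𝓝 (Q 𝕜 x ψ + Q 𝕜 y ψ)) := by
    have h := ((hlim₁ ψ).add (hlim₂ ψ)).sub hxy_lim
    rw [hzero, sub_zero] at h
    refine h.congr' ?_
    filter_upwards [hmem] with p hp
    exact (hψ.Q_Q_eq_Q_inf hB hp.1 hp.2).2.symm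
  -- This suffices, since `Q_{x ⊔ y}` fixes `Q_x ψ + Q_y ψ`.
  have hδ : Q 𝕜 (x ⊔ y) (ψ - (Q 𝕜 x ψ + Q 𝕜 y ψ)) = 0 := by
    refine Q_sup_eq_zero fun s t hs ht => ?_
    have hs0 := x.2.1 s hs
    have ht0 := y.2.1 t ht
    have hs1 : Q 𝕜 x (ind 𝕜 P hs0) = ind 𝕜 P hs0 :=
      condExpL2_indicator_of_measurable x.2.1 hs (measure_ne_top P s) 1
    have ht1 : Q 𝕜 y (ind 𝕜 P ht0) = ind 𝕜 P ht0 :=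
      condExpL2_indicator_of_measurable y.2.1 ht (measure_ne_top P t) 1
    have hlim_s := ((hlim₁ (ind 𝕜 P hs0)).const_sub (ind 𝕜 P hs0)).norm.const_mul 2
    have hlim_t := ((hlim₂ (ind 𝕜 P ht0)).const_sub (ind 𝕜 P ht0)).norm.const_mul 2
    have hlim_z := (hsup_lim.sub_const (Q 𝕜 x ψ + Q 𝕜 y ψ)).norm
    rw [hs1, sub_self, norm_zero, mul_zero] at hlim_s
    rw [ht1, sub_self, norm_zero, mul_zero] at hlim_t
    rw [sub_self, norm_zero] at hlim_z
    have hlim := ((hlim_s.add hlim_t).mul_const ‖ψ - (Q 𝕜 x ψ + Q 𝕜 y ψ)‖).add hlim_z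
    rw [add_zero, add_zero, zero_mul] at hlim
    -- The integral does not depend on `p`, while its bound tends to `0`.
    exact norm_le_zero_iff.mp (ge_of_tendsto' hlim fun p =>
      norm_setIntegral_sub_le p.1 p.2 hs0 ht0 ψ _)
  rw [Q_sub, Q_add, Q_Q_of_le le_sup_left, Q_Q_of_le le_sup_right, sub_eq_zero] at hδ
  exact hδ

theorem IsAdditiveOn.completion (hψ : IsAdditiveOn B ψ) (hB : IsNoiseType P B) :
    IsAdditiveOn (completion 𝕜 B) ψ :=
  fun x hx y hy => hψ.strongClosure hB x hx.1 y hy.1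

theorem IsNoiseType.firstChaos_completion (hB : IsNoiseType P B) :
    firstChaos 𝕜 (NoiseAlgebra.completion 𝕜 B) = firstChaos 𝕜 B :=
  le_antisymm
    (fun _ hψ x hx y hy => hψ x (hB.subset_completion hx) y (hB.subset_completion hy))
    (fun _ hψ => IsAdditiveOn.completion hψ hB)

end Completion

end NoiseAlgebra

end

theorem mainTheorem2 {𝕜 : Type*} [RCLike 𝕜] {Ω : Type*} [MeasurableSpace Ω]
    (P : MeasureTheory.Measure Ω) [MeasureTheory.IsProbabilityMeasure P]
    (B : Set (NoiseAlgebra.SigmaField P)) (hB : NoiseAlgebra.IsNoiseType P B) :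
    (∀ ψ : MeasureTheory.Lp 𝕜 2 P, NoiseAlgebra.IsAdditiveOn B ψ →
      NoiseAlgebra.IsAdditiveOn (NoiseAlgebra.completion 𝕜 B) ψ) ∧
    NoiseAlgebra.firstChaos 𝕜 B =
      NoiseAlgebra.firstChaos 𝕜 (NoiseAlgebra.completion 𝕜 B) ∧
    (NoiseAlgebra.IsClassical 𝕜 B ↔
      NoiseAlgebra.IsClassical 𝕜 (NoiseAlgebra.completion 𝕜 B)) ∧
    (NoiseAlgebra.IsBlack 𝕜 B ↔
      NoiseAlgebra.IsBlack 𝕜 (NoiseAlgebra.completion 𝕜 B)) ∧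
    (∀ B₁ : Set (NoiseAlgebra.SigmaField P), NoiseAlgebra.IsNoiseType P B₁ →
      NoiseAlgebra.completion 𝕜 B₁ = NoiseAlgebra.completion 𝕜 B →
        NoiseAlgebra.firstChaos 𝕜 B₁ = NoiseAlgebra.firstChaos 𝕜 B ∧
        (NoiseAlgebra.IsClassical 𝕜 B₁ ↔ NoiseAlgebra.IsClassical 𝕜 B) ∧
        (NoiseAlgebra.IsBlack 𝕜 B₁ ↔ NoiseAlgebra.IsBlack 𝕜 B)) := by
  have chaos := hB.firstChaos_completion (𝕜 := 𝕜)
  refine ⟨fun ψ hψ => hψ.completion hB, chaos.symm, ?_, ?_, fun B₁ hB₁ h => ?_⟩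
  · simp only [NoiseAlgebra.IsClassical, chaos]
  · simp only [NoiseAlgebra.IsBlack, chaos]
  · have h₁ : NoiseAlgebra.firstChaos 𝕜 B₁ = NoiseAlgebra.firstChaos 𝕜 B := by
      rw [← hB₁.firstChaos_completion, h, chaos]
    refine ⟨h₁, ?_, ?_⟩
    · simp only [NoiseAlgebra.IsClassical, h₁]
    · simp only [NoiseAlgebra.IsBlack, h₁]
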